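/- Let $H_1,H_2$ be real Hilbert spaces, let $f:H_1\to H_1$ be Lipschitz continuous, let $B:H_2\to H_1$, $C:H_1\to H_2$, $D:H_2\to H_2$ be bounded linear operators, and let $\mathcal F:H_2\rightrightarrows H_2$ be a set-valued operator. Write $(\mathcal F^{-1}+D)(y)=\{w+Dy:\ y\in\mathcal F(w)\}$, let $(\mathcal F^{-1}+D)^{-1}$ be the inverse set-valued operator, and let $\mathrm{rge}$ denote the range. Assume: 1. ($P$-passivity) $P:H_1\to H_1$ is a bounded linear symmetric operator with $\langle Px,x\rangle>0$ for all $x\ne0$, and for all $x_1,x_2\in H_1$, $y_1,y_2\in H_2$, $$\langle P(f(x_1)-f(x_2)),x_1-x_2\rangle+\langle (PB-C^T)(y_1-y_2),x_1-x_2\rangle+\langle D(y_1-y_2),y_1-y_2\rangle\ge 0 ;$$ moreover $D$ is semi-coercive: there is $c>0$ with $\langle Dy,y\rangle\ge c\|y\|^2$ for all $y\in\mathrm{rge}(D+D^T)$. 2. $\mathcal F$ is maximal monotone. 3. $0\in\mathrm{ri}\big(\mathrm{rge}(C)-\mathrm{rge}(\mathcal F^{-1}+D)\big)$, where $\mathrm{ri}(S)$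 is the interior of $S$ relative to its closed affine hull. 4. There is $y_0\in H_2$ such that, for every $x\in H_1$ with $Cx\in\mathrm{rge}(\mathcal F^{-1}+D)$, one has $(y_0+\mathrm{rge}(D+D^T))\cap(\mathcal F^{-1}+D)^{-1}Cx\ne\emptyset$. Let $\mathcal H:=Pf+PB(\mathcal F^{-1}+D)^{-1}C$ and let $\gamma>0$. Then the resolvent $J_{\gamma\mathcal H}=(I+\gamma\mathcal H)^{-1}$ is single-valued and defined on all of $H_1$. If, moreover, the set-valued Lur'e system $$\dot x=-f(x)+B\lambda,\qquad y=Cx+D\lambda,\qquad \lambda\in-\mathcal F(y)$$ has an equilibrium, i.e. a point $x$ with $0\in f(x)+B(\mathcal F^{-1}+D)^{-1}(Cx)$, then for every $x_0\in H_1$ the sequence $x_{n+1}=J_{\gamma\mathcal H}(x_n)$, $n\ge0$, converges weakly to some equilibrium $x^*$ of this system. -/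

import Mathlib

open Filter Topology
open scoped Pointwise InnerProductSpace

namespace Lure

section SetValued

variable {E F : Type*}

/-- The inverse of a set-valued map `A : E ⇉ F`: `A⁻¹ y = {x | y ∈ A x}`. -/
def inv (A : E → Set F) : F → Set E := fun y => {x | y ∈ A x}

/-- The range of a set-valued map: the union of all its values. -/
def rge (A : E → Set F) : Set F := ⋃ x, A x

/-- The resolvent `(I + γ A)⁻¹` of `γ A`, as a set-valued map:
`y ∈ resolvent γ A x` iff `x ∈ y + γ A y`. -/
def resolvent [AddCommGroup E] [Module ℝ E] (γ : ℝ) (A : E → Set E) : E → Set E :=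
  inv (fun y => {y} + γ • A y)

end SetValued

section Hilbert

variable {E : Type*} [NormedAddCommGroup E] [InnerProductSpace ℝ E]

/-- Monotone set-valued operators. -/
def IsMonotone (A : E → Set E) : Prop :=
  ∀ x y : E, ∀ u ∈ A x, ∀ v ∈ A y, 0 ≤ ⟪u - v, x - y⟫_ℝ

/-- Maximal monotone operators: monotone, and no monotone operator has a strictly larger graph. -/
def IsMaximalMonotone (A : E → Set E) : Prop :=
  IsMonotone A ∧ ∀ A' : E → Set E, IsMonotone A' → (∀ x, A x ⊆ A' x) → A' = A

/-- A bounded operator `D` is semi-coercive if `⟨D x, x⟩ ≥ c ‖x‖²` on the range of `D + Dᵀ`,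
for some `c > 0`. -/
def IsSemiCoercive [CompleteSpace E] (D : E →L[ℝ] E) : Prop :=
  ∃ c : ℝ, 0 < c ∧ ∀ x ∈ Set.range (D + D.adjoint), c * ‖x‖ ^ 2 ≤ ⟪D x, x⟫_ℝ

/-- The relative interior of a subset of a Hilbert space: its interior relative to its closed
affine hull. -/
def relInterior (S : Set E) : Set E :=
  {x ∈ S | ∃ ε : ℝ, 0 < ε ∧ Metric.ball x ε ∩ closure (affineSpan ℝ S : Set E) ⊆ S}

end Hilbert

section System

variable {H₁ H₂ : Type*}
  [NormedAddCommGroup H₁] [InnerProductSpace ℝ H₁] [CompleteSpace H₁]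
  [NormedAddCommGroup H₂] [InnerProductSpace ℝ H₂] [CompleteSpace H₂]

/-- `P`-passivity of the system `(f, B, C, D)`: the operator `P` is symmetric and positive
(`⟨P x, x⟩ > 0` for `x ≠ 0`) and the dissipation inequality holds. -/
structure IsPassive (P : H₁ →L[ℝ] H₁) (f : H₁ → H₁) (B : H₂ →L[ℝ] H₁) (C : H₁ →L[ℝ] H₂)
    (D : H₂ →L[ℝ] H₂) : Prop where
  symmetric : IsSelfAdjoint P
  pos : ∀ x : H₁, x ≠ 0 → 0 < ⟪P x, x⟫_ℝ
  passive : ∀ (x₁ x₂ : H₁) (y₁ y₂ : H₂),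
    0 ≤ ⟪P (f x₁ - f x₂), x₁ - x₂⟫_ℝ
      + ⟪(P ∘L B - C.adjoint) (y₁ - y₂), x₁ - x₂⟫_ℝ
      + ⟪D (y₁ - y₂), y₁ - y₂⟫_ℝ

/-- The set-valued operator `𝓕⁻¹ + D`. -/
def invAdd (𝓕 : H₂ → Set H₂) (D : H₂ →L[ℝ] H₂) : H₂ → Set H₂ :=
  fun y => inv 𝓕 y + {D y}

/-- The set-valued operator `P f + P B (𝓕⁻¹ + D)⁻¹ C` on `H₁`. -/
def lureOp (P : H₁ →L[ℝ] H₁) (f : H₁ → H₁) (B : H₂ →L[ℝ] H₁) (C : H₁ →L[ℝ] H₂)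
    (D : H₂ →L[ℝ] H₂) (𝓕 : H₂ → Set H₂) : H₁ → Set H₁ :=
  fun x => {P (f x)} + (P ∘L B) '' (inv (invAdd 𝓕 D) (C x))

/-- `x` is an equilibrium of the set-valued Lur'e system
`x' = - f x + B λ`, `y = C x + D λ`, `λ ∈ - 𝓕 y`, that is,
`0 ∈ f x + B (𝓕⁻¹ + D)⁻¹ (C x)`. -/
def IsEquilibrium (f : H₁ → H₁) (B : H₂ →L[ℝ] H₁) (C : H₁ →L[ℝ] H₂)
    (D : H₂ →L[ℝ] H₂) (𝓕 : H₂ → Set H₂) (x : H₁) : Prop :=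
  (0 : H₁) ∈ {f x} + B '' (inv (invAdd 𝓕 D) (C x))

end System

end Lure

/-!
The operator `𝓗 = P f + P B (𝓕⁻¹ + D)⁻¹ C` is monotone: the passivity inequality bounds the increment
of `𝓗` below by that of the monotone operator `𝓕` along its graph (`IsPassive.le_inner`). Once
`I + γ 𝓗` is known to be onto, its resolvent is single-valued and nonexpansive, and the weak
convergence of the iterates is that of the proximal point algorithm (`tendsto_proximal_point`): the
iterates are Fejér monotone, weak cluster points are zeros of `𝓗`, and Opial's argument shows that
there is only one. Zeros of `𝓗` are equilibria because `P` is injective.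

Surjectivity of `I + γ 𝓗` (`IsPassive.hasFullResolvent_lureOp`) is obtained by regularization. By
Minty's theorem, `𝓕⁻¹` has full resolvents, and so does its Lipschitz perturbation `𝓕⁻¹ + D`. The
Yosida approximation `(𝓕⁻¹ + D + r I)⁻¹` is Lipschitz, and replacing `(𝓕⁻¹ + D)⁻¹` by it keeps `𝓗`
monotone, so the regularized equation has a solution `z` with multiplier `v`, where
`C z - r v ∈ (𝓕⁻¹ + D) v`. Comparison with a pair `x'`, `d ∈ (𝓕⁻¹ + D) e` bounds `-⟪v, C x' - d⟫`
independently of `r`. Such vectors `C x' - d` fill a neighbourhood of `0` in a closed subspace which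
contains `v`, by the condition on the relative interior, so the uniform boundedness principle bounds
`v`. Then the states `z` form a Cauchy sequence as `r → 0`, the multipliers have a weak limit, and
maximality of `𝓕⁻¹ + D` identifies the limit as a solution.
-/

namespace Lure

section General

/-! ### Weak limits and a common point of balls -/

variable {E : Type*} [NormedAddCommGroup E] [InnerProductSpace ℝ E]

/-- A bounded family in a Hilbert space converges weakly along every ultrafilter. This replaces the
extraction of weakly convergent subsequences. -/
theorem exists_weak_limit [CompleteSpace E] {ι : Type*} (U : Ultrafilter ι) (v : ι → E) (K : ℝ)
    (hv : ∀ᶠ i in (U : Filter ι), ‖v i‖ ≤ K) :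
    ∃ w : E, ∀ h : E, Tendsto (fun i => ⟪v i, h⟫_ℝ) U (𝓝 ⟪w, h⟫_ℝ) := by
  have hbd : ∀ h : E, ∀ᶠ i in (U : Filter ι), |⟪v i, h⟫_ℝ| ≤ K * ‖h‖ := fun h => by
    filter_upwards [hv] with i hi
    exact (abs_real_inner_le_norm _ _).trans (by gcongr)
  have hlim : ∀ h : E, ∃ l : ℝ, Tendsto (fun i => ⟪v i, h⟫_ℝ) U (𝓝 l) := fun h => by
    have hc : IsCompact (Set.Icc (-(K * ‖h‖)) (K * ‖h‖)) := isCompact_Icc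
    obtain ⟨l, -, hl⟩ := hc.ultrafilter_le_nhds (U.map fun i => ⟪v i, h⟫_ℝ) (by
      rw [le_principal_iff]
      exact (hbd h).mono fun i hi => abs_le.mp hi)
    exact ⟨l, hl⟩
  choose l hl using hlim
  have hadd : ∀ x y, l (x + y) = l x + l y := fun x y =>
    tendsto_nhds_unique (hl (x + y)) (by simpa only [inner_add_right] using (hl x).add (hl y))
  have hsmul : ∀ (c : ℝ) x, l (c • x) = c • l x := fun c x =>
    tendsto_nhds_unique (hl (c • x)) (by
      simpa only [inner_smul_right, smul_eq_mul] using (hl x).const_mul c)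
  let φ : E →L[ℝ] ℝ := LinearMap.mkContinuous ⟨⟨l, hadd⟩, hsmul⟩ K fun h =>
    le_of_tendsto (hl h).abs (hbd h)
  refine ⟨(InnerProductSpace.toDual ℝ E).symm φ, fun h => ?_⟩
  rw [InnerProductSpace.toDual_symm_apply]
  exact hl h

/-- Finitely many balls `{x | ⟪b i + x, x - a i⟫ ≤ 0}`, with centre `(a i - b i) / 2`, have a common
point when the pairs `(a i, b i)` form a monotone graph. The point comes from a maximizer of the
Lagrangian dual of `min_x max_i ⟪b i + x, x - a i⟫` over the simplex. -/
theorem exists_common_point_of_fintype {ι : Type*} [Fintype ι] [Nonempty ι] (a b : ι → E)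
    (hab : ∀ i j, 0 ≤ ⟪b i - b j, a i - a j⟫_ℝ) :
    ∃ x : E, ∀ i, ⟪b i + x, x - a i⟫_ℝ ≤ 0 := by
  classical
  -- `-‖X t‖ ^ 2 - k t` is the minimum over `x` of `∑ i, t i * ⟪b i + x, x - a i⟫`, attained at `X t`
  let c : ι → E := fun i => (1 / 2 : ℝ) • (a i - b i)
  let X : (ι → ℝ) → E := fun t => ∑ i, t i • c i
  let k : (ι → ℝ) → ℝ := fun t => ∑ i, t i * ⟪b i, a i⟫_ℝ
  have hX : Continuous X := by fun_prop
  have hk : Continuous k := by fun_prop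
  obtain ⟨t, ht, hmax⟩ := (isCompact_stdSimplex ℝ ι).exists_isMaxOn
    ⟨_, single_mem_stdSimplex ℝ (Classical.arbitrary ι)⟩
    (f := fun t => -‖X t‖ ^ 2 - k t) (by fun_prop)
  -- by monotonicity, the dual value is at most `-‖∑ i, t i • (a i + b i)‖ ^ 2 / 4`
  have hval : -‖X t‖ ^ 2 - k t ≤ 0 := by
    set α := ∑ i, t i • a i
    set β := ∑ i, t i • b i
    have hXt : X t = (1 / 2 : ℝ) • (α - β) := by
      simp only [X, c, α, β, ← Finset.sum_sub_distrib, Finset.smul_sum, smul_sub, smul_comm (1/2 : ℝ)]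
    have h0 : 0 ≤ ∑ i, ∑ j, t i * t j * ⟪b i - b j, a i - a j⟫_ℝ :=
      Finset.sum_nonneg fun i _ => Finset.sum_nonneg fun j _ =>
        mul_nonneg (mul_nonneg (ht.1 i) (ht.1 j)) (hab i j)
    have h1 : ∑ i, ∑ j, t i * t j * ⟪b i - b j, a i - a j⟫_ℝ = 2 * k t - 2 * ⟪β, α⟫_ℝ := by
      have hs := ht.2
      have e1 : ∑ i, ∑ j, t i * t j * ⟪b i, a i⟫_ℝ = k t := by
        simp_rw [k, mul_right_comm (t _) (t _), ← Finset.mul_sum, hs, mul_one]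
      have e2 : ∑ i, ∑ j, t i * t j * ⟪b j, a j⟫_ℝ = k t := by
        rw [Finset.sum_comm, ← e1]
        simp_rw [mul_comm (t _) (t _)]
      have e3 : ∑ i, ∑ j, t i * t j * ⟪b i, a j⟫_ℝ = ⟪β, α⟫_ℝ := by
        simp_rw [α, β, sum_inner, inner_sum, real_inner_smul_left, real_inner_smul_right, mul_assoc]
      have e4 : ∑ i, ∑ j, t i * t j * ⟪b j, a i⟫_ℝ = ⟪β, α⟫_ℝ := by
        rw [Finset.sum_comm, ← e3]
        simp_rw [mul_comm (t _) (t _)]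
      have : ∀ i j, t i * t j * ⟪b i - b j, a i - a j⟫_ℝ = t i * t j * ⟪b i, a i⟫_ℝ
          + t i * t j * ⟪b j, a j⟫_ℝ - t i * t j * ⟪b i, a j⟫_ℝ - t i * t j * ⟪b j, a i⟫_ℝ := by
        intro i j
        simp only [inner_sub_left, inner_sub_right]
        ring
      simp_rw [this, Finset.sum_sub_distrib, Finset.sum_add_distrib, e1, e2, e3, e4]
      ring
    have h2 : ‖X t‖ ^ 2 = (‖α + β‖ ^ 2 - 4 * ⟪β, α⟫_ℝ) / 4 := by
      rw [hXt, norm_smul, mul_pow, norm_sub_sq_real, norm_add_sq_real, real_inner_comm]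
      norm_num
      ring
    nlinarith [sq_nonneg ‖α + β‖]
  refine ⟨X t, fun i => ?_⟩
  have hc : ⟪b i + X t, X t - a i⟫_ℝ = ‖X t‖ ^ 2 - 2 * ⟪X t, c i⟫_ℝ - ⟪b i, a i⟫_ℝ := by
    simp only [c, inner_sub_right, inner_add_left, inner_smul_right, real_inner_self_eq_norm_sq,
      real_inner_comm (X t) (b i)]
    ring
  -- optimality of `t` on the segment towards the vertex `i`; the limit `s → 0` bounds the value of
  -- the `i`-th constraint at `X t` by the dual value
  have hline : ∀ s : ℝ, 0 < s → s ≤ 1 →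
      2 * ‖X t‖ ^ 2 - 2 * ⟪X t, c i⟫_ℝ + k t - ⟪b i, a i⟫_ℝ ≤ s * ‖X t - c i‖ ^ 2 := by
    intro s hs hs1
    have hmem : (1 - s) • t + s • Pi.single i (1 : ℝ) ∈ stdSimplex ℝ ι :=
      convex_stdSimplex ℝ ι ht (single_mem_stdSimplex ℝ i) (by linarith) hs.le (by ring)
    have hle := hmax hmem
    have hX' : X ((1 - s) • t + s • Pi.single i (1 : ℝ)) = (1 - s) • X t + s • c i := by
      simp [X, add_smul, Finset.sum_add_distrib, Finset.smul_sum, mul_smul, Pi.single_apply,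
        ite_smul]
    have hk' : k ((1 - s) • t + s • Pi.single i (1 : ℝ)) = (1 - s) * k t + s * ⟪b i, a i⟫_ℝ := by
      simp [k, add_mul, Finset.sum_add_distrib, Finset.mul_sum, mul_assoc, Pi.single_apply]
    simp only [Set.mem_ofPred_eq, hX', hk'] at hle
    have hn : ‖(1 - s) • X t + s • c i‖ ^ 2
        = ‖X t‖ ^ 2 - 2 * s * (‖X t‖ ^ 2 - ⟪X t, c i⟫_ℝ) + s ^ 2 * ‖X t - c i‖ ^ 2 := by
      rw [norm_add_sq_real, norm_sub_sq_real, norm_smul, norm_smul, real_inner_smul_left,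
        real_inner_smul_right, mul_pow, mul_pow, Real.norm_eq_abs, Real.norm_eq_abs, sq_abs, sq_abs]
      ring
    rw [hn] at hle
    refine le_of_mul_le_mul_left ?_ hs
    linarith
  have hlim : 2 * ‖X t‖ ^ 2 - 2 * ⟪X t, c i⟫_ℝ + k t - ⟪b i, a i⟫_ℝ ≤ 0 := by
    have : Tendsto (fun s : ℝ => s * ‖X t - c i‖ ^ 2) (𝓝[>] 0) (𝓝 0) := by
      have h : Continuous fun s : ℝ => s * ‖X t - c i‖ ^ 2 := by fun_prop
      simpa using (h.tendsto 0).mono_left nhdsWithin_le_nhds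
    refine ge_of_tendsto this ?_
    filter_upwards [Ioo_mem_nhdsGT (zero_lt_one' ℝ)] with s hs
    exact hline s hs.1 hs.2.le
  linarith

/-- The infinite version: choose common points of the finite subfamilies and pass to a weak limit
along an ultrafilter on the finite sets. -/
theorem exists_common_point [CompleteSpace E] {ι : Type*} (a b : ι → E)
    (hab : ∀ i j, 0 ≤ ⟪b i - b j, a i - a j⟫_ℝ) :
    ∃ x : E, ∀ i, ⟪b i + x, x - a i⟫_ℝ ≤ 0 := by
  classical
  rcases isEmpty_or_nonempty ι with hι | ⟨⟨i₀⟩⟩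
  · exact ⟨0, fun i => (hι.false i).elim⟩
  have hfin : ∀ s : Finset ι, ∃ x : E, ∀ i ∈ s, ⟪b i + x, x - a i⟫_ℝ ≤ 0 := fun s => by
    rcases s.eq_empty_or_nonempty with rfl | hs
    · exact ⟨0, by simp⟩
    · have := hs.to_subtype
      obtain ⟨x, hx⟩ := exists_common_point_of_fintype (fun i : s => a i) (fun i : s => b i)
        fun i j => hab i j
      exact ⟨x, fun i hi => hx ⟨i, hi⟩⟩
  choose x hx using hfin
  let U : Ultrafilter (Finset ι) := Ultrafilter.of atTop
  have hU : (U : Filter (Finset ι)) ≤ atTop := Ultrafilter.of_le _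
  have hev : ∀ i, ∀ᶠ s in (U : Filter (Finset ι)), ⟪b i + x s, x s - a i⟫_ℝ ≤ 0 := fun i => by
    filter_upwards [hU (eventually_ge_atTop {i})] with s hs
    exact hx s i (hs (Finset.mem_singleton_self i))
  obtain ⟨y, hy⟩ := exists_weak_limit U x (2 * (‖a i₀‖ + ‖b i₀‖)) (by
    filter_upwards [hev i₀] with s hs
    have e : ⟪b i₀ + x s, x s - a i₀⟫_ℝ
        = ‖x s‖ ^ 2 + ⟪b i₀, x s⟫_ℝ - ⟪x s, a i₀⟫_ℝ - ⟪b i₀, a i₀⟫_ℝ := by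
      simp only [inner_sub_right, inner_add_left, real_inner_self_eq_norm_sq]
      ring
    have h1 := neg_le_of_abs_le (abs_real_inner_le_norm (b i₀) (x s))
    have h2 := le_of_abs_le (abs_real_inner_le_norm (x s) (a i₀))
    have h3 := le_of_abs_le (abs_real_inner_le_norm (b i₀) (a i₀))
    by_contra! hlt
    have h4 : 0 < ‖x s‖ := lt_of_le_of_lt (by positivity) hlt
    nlinarith [mul_pos h4 (sub_pos.mpr hlt), norm_nonneg (a i₀), norm_nonneg (b i₀),
      norm_nonneg (x s)])
  refine ⟨y, fun i => ?_⟩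
  have hlim := ((hy y).const_mul 2).add (hy (b i - a i))
  -- weak lower semicontinuity of the square of the norm, through `‖x‖ ^ 2 ≥ 2 ⟪x, y⟫ - ‖y‖ ^ 2`
  have hle : 2 * ⟪y, y⟫_ℝ + ⟪y, b i - a i⟫_ℝ ≤ ‖y‖ ^ 2 + ⟪b i, a i⟫_ℝ := by
    refine le_of_tendsto hlim ?_
    filter_upwards [hev i] with s hs
    have h0 : 0 ≤ ‖x s - y‖ ^ 2 := sq_nonneg _
    rw [norm_sub_sq_real] at h0
    simp only [inner_sub_right, inner_add_left, real_inner_self_eq_norm_sq,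
      real_inner_comm (x s) (b i)] at hs ⊢
    linarith
  simp only [inner_sub_right, inner_add_left, real_inner_self_eq_norm_sq,
      real_inner_comm y (b i)] at hle ⊢
  linarith

/-! ### Monotone operators with everywhere defined resolvents -/

/-- A maximal monotone graph contains every pair that is monotonically related to it. -/
theorem IsMaximalMonotone.mem_of_forall {A : E → Set E} (hA : IsMaximalMonotone A) {x u : E}
    (h : ∀ y, ∀ v ∈ A y, 0 ≤ ⟪u - v, x - y⟫_ℝ) : u ∈ A x := by
  have key := hA.2 (fun y => A y ∪ {v | y = x ∧ v = u}) (by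
    rintro y z v (hv | ⟨rfl, rfl⟩) w (hw | ⟨rfl, rfl⟩)
    · exact hA.1 y z v hv w hw
    · rw [← neg_sub, ← neg_sub z y, inner_neg_neg]
      exact h y v hv
    · exact h z w hw
    · simp) fun y => Set.subset_union_left
  rw [← key]
  exact Or.inr ⟨rfl, rfl⟩

theorem IsMonotone.inv {A : E → Set E} (hA : IsMonotone A) : IsMonotone (inv A) := by
  intro x y u hu v hv
  rw [real_inner_comm]
  exact hA u v x hu y hv

/-- `I + γ A` is surjective for every `γ > 0`. For monotone operators on a Hilbert space this is
equivalent to maximality, by Minty's theorem. -/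
def HasFullResolvent (A : E → Set E) : Prop :=
  ∀ γ : ℝ, 0 < γ → ∀ p : E, ∃ z, ∃ u ∈ A z, z + γ • u = p

/-- **Minty's theorem**, stated for the inverse of a maximal monotone operator: solving
`z + γ u = p` with `z ∈ A u` amounts to finding `z` with `⟪(γ b - p) + z, z - a⟫ ≤ 0` for all
`a ∈ A b`, a common point of balls. -/
theorem IsMaximalMonotone.hasFullResolvent_inv [CompleteSpace E] {A : E → Set E}
    (hA : IsMaximalMonotone A) : HasFullResolvent (Lure.inv A) := by
  intro γ hγ p
  obtain ⟨z, hz⟩ := exists_common_point (ι := {q : E × E // q.1 ∈ A q.2})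
    (fun q => q.1.1) (fun q => γ • q.1.2 - p) (fun q r => by
      rw [sub_sub_sub_cancel_right, ← smul_sub, real_inner_smul_left, real_inner_comm]
      exact mul_nonneg hγ.le (hA.1 _ _ _ q.2 _ r.2))
  refine ⟨z, γ⁻¹ • (p - z), hA.mem_of_forall fun y v hv => ?_, by
    rw [smul_inv_smul₀ hγ.ne']; abel⟩
  have h := hz ⟨(v, y), hv⟩
  have e : γ⁻¹ • (p - z) - y = -(γ⁻¹ • (γ • y - p + z)) := by
    rw [smul_add, smul_sub, smul_sub, inv_smul_smul₀ hγ.ne']; abel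
  rw [e, inner_neg_right, real_inner_smul_right, real_inner_comm]
  have := mul_nonneg (inv_nonneg.mpr hγ.le) (neg_nonneg.mpr h)
  linarith

/-- The resolvent of a monotone operator is nonexpansive. -/
theorem IsMonotone.norm_sub_le {A : E → Set E} (hA : IsMonotone A) {γ : ℝ} (hγ : 0 < γ)
    {x y u v : E} (hu : u ∈ A x) (hv : v ∈ A y) :
    ‖x - y‖ ≤ ‖(x + γ • u) - (y + γ • v)‖ := by
  have h := mul_nonneg hγ.le (hA x y u hu v hv)
  have e : (x + γ • u) - (y + γ • v) = (x - y) + γ • (u - v) := by rw [smul_sub]; abel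
  rw [e]
  refine le_of_sq_le_sq ?_ (norm_nonneg _)
  rw [norm_add_sq_real, real_inner_smul_right, real_inner_comm]
  nlinarith [sq_nonneg ‖γ • (u - v)‖]

/-- The easy half of Minty's theorem: full range of `I + A` gives maximality. -/
theorem HasFullResolvent.mem_of_forall {A : E → Set E} (hsurj : HasFullResolvent A) {x u : E}
    (h : ∀ y, ∀ v ∈ A y, 0 ≤ ⟪u - v, x - y⟫_ℝ) : u ∈ A x := by
  obtain ⟨z, w, hw, e⟩ := hsurj 1 one_pos (x + u)
  rw [one_smul] at e
  have h1 := h z w hw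
  have e1 : u - w = -(x - z) := by
    rw [eq_sub_of_add_eq' e.symm]; abel
  rw [e1, inner_neg_left, real_inner_self_eq_norm_sq] at h1
  have h2 : x - z = 0 := by
    rw [← norm_eq_zero]
    exact pow_eq_zero_iff two_ne_zero |>.mp (le_antisymm (by linarith) (sq_nonneg _))
  rw [h2, neg_zero, sub_eq_zero] at e1
  rw [sub_eq_zero] at h2
  rwa [e1, h2]

/-- A Lipschitz perturbation whose sum with `A` is monotone preserves full resolvents. -/
theorem exists_resolvent_add_lipschitz [CompleteSpace E] {A : E → Set E} (hA : IsMonotone A)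
    (hsurj : HasFullResolvent A) {G : E → E} {L : NNReal} (hG : LipschitzWith L G)
    (hAG : IsMonotone fun x => A x + {G x}) : HasFullResolvent fun x => A x + {G x} := by
  intro γ hγ p
  -- for a small step `δ`, `z ∈ (I + δ (A + G))⁻¹ q` is a fixed point of the contraction
  -- `z ↦ (I + δ A)⁻¹ (q - δ G z)`
  obtain ⟨δ, hδ, hδγ, hδL⟩ : ∃ δ : ℝ, 0 < δ ∧ δ ≤ γ ∧ δ * L < 1 := by
    refine ⟨min γ (1 / (L + 1)), by positivity, min_le_left _ _, ?_⟩
    calc min γ (1 / ((L : ℝ) + 1)) * L ≤ 1 / (L + 1) * L := by gcongr; exact min_le_right _ _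
      _ < 1 := by rw [one_div_mul_eq_div, div_lt_one (by positivity)]; linarith
  have hsmall : ∀ q : E, ∃ z, ∃ u ∈ A z + {G z}, z + δ • u = q := by
    intro q
    choose J w hw hJ using hsurj δ hδ
    let T : E → E := fun z => J (q - δ • G z)
    have hT : ContractingWith (Real.toNNReal (δ * L)) T := by
      refine ⟨by rwa [Real.toNNReal_lt_one], LipschitzWith.of_dist_le_mul fun x y => ?_⟩
      rw [Real.coe_toNNReal _ (by positivity), dist_eq_norm, dist_eq_norm]
      have h1 := hA.norm_sub_le hδ (hw (q - δ • G x)) (hw (q - δ • G y))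
      rw [hJ, hJ, sub_sub_sub_cancel_left, ← smul_sub, norm_smul, Real.norm_of_nonneg hδ.le,
        ← norm_neg (G y - G x), neg_sub] at h1
      have h2 := hG.dist_le_mul x y
      rw [dist_eq_norm, dist_eq_norm] at h2
      calc _ ≤ _ := h1
        _ ≤ δ * (L * ‖x - y‖) := by gcongr
        _ = _ := by ring
    have hz := hT.fixedPoint_isFixedPt
    set z := ContractingWith.fixedPoint T hT
    have hz' : J (q - δ • G z) = z := hz
    have h1 := hw (q - δ • G z)
    have h2 := hJ (q - δ • G z)
    rw [hz'] at h1 h2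
    exact ⟨z, _, Set.add_mem_add h1 rfl, by rw [smul_add, ← add_assoc, h2]; abel⟩
  -- the step `γ` is reached from `δ`: `z + γ u = p` if and only if
  -- `z + δ u = (δ / γ) p + (1 - δ / γ) z`, a fixed point problem for a contraction
  choose J w hw hJ using hsmall
  let T : E → E := fun z => J ((δ / γ) • p + (1 - δ / γ) • z)
  have hr : 0 < δ / γ := by positivity
  have hr1 : δ / γ ≤ 1 := (div_le_one hγ).mpr hδγ
  have hT : ContractingWith (Real.toNNReal (1 - δ / γ)) T := by
    refine ⟨by rw [Real.toNNReal_lt_one]; linarith, LipschitzWith.of_dist_le_mul fun x y => ?_⟩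
    rw [Real.coe_toNNReal _ (by linarith), dist_eq_norm, dist_eq_norm]
    have h1 := hAG.norm_sub_le hδ (hw ((δ / γ) • p + (1 - δ / γ) • x))
      (hw ((δ / γ) • p + (1 - δ / γ) • y))
    rwa [hJ, hJ, add_sub_add_left_eq_sub, ← smul_sub, norm_smul,
      Real.norm_of_nonneg (by linarith)] at h1
  have hz := hT.fixedPoint_isFixedPt
  set z := ContractingWith.fixedPoint T hT
  have hz' : J ((δ / γ) • p + (1 - δ / γ) • z) = z := hz
  have h1 := hw ((δ / γ) • p + (1 - δ / γ) • z)
  have h2 := hJ ((δ / γ) • p + (1 - δ / γ) • z)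
  rw [hz'] at h1 h2
  refine ⟨z, _, h1, ?_⟩
  generalize w ((δ / γ) • p + (1 - δ / γ) • z) = u at h2
  have h3 : δ • u = (δ / γ) • (p - z) := by
    rw [sub_smul, one_smul, add_comm, ← sub_eq_iff_eq_add] at h2
    rw [smul_sub, ← sub_eq_zero, ← sub_eq_zero.mpr h2]; abel
  have h4 : γ • u = p - z := by
    have := congrArg (fun y => (γ / δ) • y) h3
    simpa only [smul_smul, div_mul_cancel₀ γ hδ.ne', div_mul_div_cancel₀ hδ.ne',
      div_self hγ.ne', one_smul] using this
  rw [h4]; abel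

/-- `I + γ G` is surjective for `G` monotone and Lipschitz. -/
theorem exists_add_smul_eq_of_lipschitz [CompleteSpace E] {G : E → E} {L : NNReal}
    (hG : LipschitzWith L G) (hmono : ∀ x y, 0 ≤ ⟪G x - G y, x - y⟫_ℝ) {γ : ℝ} (hγ : 0 < γ) (p : E) :
    ∃ z, z + γ • G z = p := by
  obtain ⟨z, u, hu, hz⟩ := exists_resolvent_add_lipschitz (A := fun _ : E => {(0 : E)})
    (by simp [IsMonotone]) (fun γ _ p => ⟨p, 0, rfl, by simp⟩) hG (by simpa [IsMonotone] using hmono)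
    γ hγ p
  obtain rfl : u = G z := by simpa using hu
  exact ⟨z, hz⟩

/-! ### Relative interiors and uniform boundedness -/

/-- A set with `0` in its relative interior is absorbing in a closed subspace that contains it. -/
theorem exists_smul_mem_of_relInterior {S : Set E} (h0 : (0 : E) ∈ relInterior S) :
    ∃ V : Submodule ℝ E, IsClosed (V : Set E) ∧ S ⊆ V ∧
      ∀ w ∈ V, ∃ t : ℝ, 0 < t ∧ t • w ∈ S := by
  obtain ⟨hS, ε, hε, hball⟩ := h0
  have hspan : (affineSpan ℝ S : Set E) = Submodule.span ℝ S := by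
    rw [← affineSpan_insert_zero, Set.insert_eq_of_mem hS]
  rw [hspan, ← Submodule.topologicalClosure_coe] at hball
  refine ⟨_, Submodule.isClosed_topologicalClosure _,
    Submodule.subset_span.trans (Submodule.le_topologicalClosure _), fun w hw => ?_⟩
  refine ⟨ε / (‖w‖ + 1), by positivity, hball ⟨?_, Submodule.smul_mem _ _ hw⟩⟩
  rw [mem_ball_zero_iff, norm_smul, Real.norm_of_nonneg (by positivity), div_mul_eq_mul_div,
    div_lt_iff₀ (by positivity)]
  nlinarith

/-- A uniform boundedness principle with one-sided bounds on a set `S` with `0` in its relative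
interior, for vectors in the directions of `S`. -/
theorem exists_norm_bound [CompleteSpace E] {S : Set E} (h0 : (0 : E) ∈ relInterior S)
    {ι : Type*} {v : ι → E} {r : ι → ℝ} (hr : ∀ i, 0 < r i) (hv : ∀ i, r i • v i ∈ S)
    (hK : ∀ w ∈ S, ∃ K, ∀ i, -⟪v i, w⟫_ℝ ≤ K) : ∃ K, ∀ i, ‖v i‖ ≤ K := by
  obtain ⟨V, hVc, hSV, habs⟩ := exists_smul_mem_of_relInterior h0
  have : CompleteSpace V := hVc.completeSpace_coe
  have hvV : ∀ i, v i ∈ V := fun i => by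
    have := V.smul_mem (r i)⁻¹ (hSV (hv i))
    rwa [inv_smul_smul₀ (hr i).ne'] at this
  have hK' : ∀ w ∈ V, ∃ K, ∀ i, -⟪v i, w⟫_ℝ ≤ K := fun w hw => by
    obtain ⟨t, ht, hmem⟩ := habs w hw
    obtain ⟨K, hK⟩ := hK _ hmem
    refine ⟨K / t, fun i => ?_⟩
    rw [le_div_iff₀ ht]
    have := hK i
    rw [real_inner_smul_right] at this
    linarith
  obtain ⟨K, hK⟩ := banach_steinhaus (g := fun i => innerSL ℝ (⟨v i, hvV i⟩ : V)) fun w => by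
    obtain ⟨K₁, h₁⟩ := hK' w w.2
    obtain ⟨K₂, h₂⟩ := hK' (-w) (V.neg_mem w.2)
    refine ⟨max K₁ K₂, fun i => ?_⟩
    have h₂ := h₂ i
    rw [inner_neg_right, neg_neg] at h₂
    rw [innerSL_apply_apply, Submodule.coe_inner, Real.norm_eq_abs, abs_le']
    exact ⟨h₂.trans (le_max_right _ _), (h₁ i).trans (le_max_left _ _)⟩
  exact ⟨K, fun i => by simpa using hK i⟩

/-! ### The proximal point algorithm -/

theorem mem_resolvent_iff {γ : ℝ} {A : E → Set E} {x z : E} :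
    z ∈ resolvent γ A x ↔ ∃ u ∈ A z, z + γ • u = x := by
  change x ∈ {z} + γ • A z ↔ _
  simp only [Set.mem_add, Set.mem_singleton_iff, Set.mem_smul_set, exists_eq_left,
    exists_exists_and_eq_and]

/-- Fejér monotonicity of the resolvent step with respect to a zero `e`. -/
theorem IsMonotone.norm_sub_sq_add_le {A : E → Set E} (hA : IsMonotone A) {γ : ℝ} (hγ : 0 < γ)
    {e z u : E} (he : (0 : E) ∈ A e) (hu : u ∈ A z) :
    ‖z - e‖ ^ 2 + ‖γ • u‖ ^ 2 ≤ ‖z + γ • u - e‖ ^ 2 := by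
  have h := mul_nonneg hγ.le (hA z e u hu 0 he)
  rw [sub_zero] at h
  rw [add_sub_right_comm, norm_add_sq_real, real_inner_smul_right, real_inner_comm]
  linarith

/-- The proximal point algorithm converges weakly to a zero, if there is one. -/
theorem tendsto_proximal_point [CompleteSpace E] {A : E → Set E} (hA : IsMonotone A)
    (hsurj : HasFullResolvent A) {γ : ℝ} (hγ : 0 < γ) (hzero : ∃ e, (0 : E) ∈ A e)
    {x : ℕ → E} (hx : ∀ n, x (n + 1) ∈ resolvent γ A (x n)) :
    ∃ xs, (0 : E) ∈ A xs ∧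
      Tendsto (fun n => toWeakSpace ℝ E (x n)) atTop (𝓝 (toWeakSpace ℝ E xs)) := by
  simp only [mem_resolvent_iff] at hx
  choose u hu hxu using hx
  have hfejer : ∀ e, (0 : E) ∈ A e → ∀ n,
      ‖x (n + 1) - e‖ ^ 2 + ‖γ • u n‖ ^ 2 ≤ ‖x n - e‖ ^ 2 := fun e he n => by
    simpa only [hxu] using hA.norm_sub_sq_add_le hγ he (hu n)
  have hconv : ∀ e, (0 : E) ∈ A e → ∃ l, Tendsto (fun n => ‖x n - e‖ ^ 2) atTop (𝓝 l) :=
    fun e he => ⟨_, tendsto_atTop_ciInf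
      (antitone_nat_of_succ_le fun n => by nlinarith [hfejer e he n, sq_nonneg ‖γ • u n‖])
      ⟨0, by rintro _ ⟨n, rfl⟩; positivity⟩⟩
  obtain ⟨e₀, he₀⟩ := hzero
  have hbd : ∀ n, ‖x n‖ ≤ ‖x 0 - e₀‖ + ‖e₀‖ := fun n => by
    have h1 : ‖x n - e₀‖ ^ 2 ≤ ‖x 0 - e₀‖ ^ 2 :=
      antitone_nat_of_succ_le (f := fun n => ‖x n - e₀‖ ^ 2)
        (fun n => by nlinarith [hfejer e₀ he₀ n, sq_nonneg ‖γ • u n‖]) (Nat.zero_le n)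
    have h2 := le_of_sq_le_sq h1 (norm_nonneg _)
    calc ‖x n‖ = ‖(x n - e₀) + e₀‖ := by rw [sub_add_cancel]
      _ ≤ ‖x n - e₀‖ + ‖e₀‖ := norm_add_le _ _
      _ ≤ _ := by gcongr
  have hu0 : Tendsto u atTop (𝓝 0) := by
    obtain ⟨l, hl⟩ := hconv e₀ he₀
    have h1 : Tendsto (fun n => ‖γ • u n‖ ^ 2) atTop (𝓝 0) := by
      refine squeeze_zero (fun n => sq_nonneg _) (fun n => ?_)
        (by simpa using hl.sub ((tendsto_add_atTop_iff_nat 1).mpr hl))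
      have := hfejer e₀ he₀ n
      linarith
    have h2 : Tendsto (fun n => ‖γ • u n‖) atTop (𝓝 0) := by
      simpa [Real.sqrt_sq] using h1.sqrt
    have h3 := (tendsto_zero_iff_norm_tendsto_zero.mpr h2).const_smul γ⁻¹
    simpa only [inv_smul_smul₀ hγ.ne', smul_zero] using h3
  -- weak cluster points are zeros, since the graph of `A` is closed for weak × strong convergence
  have hcluster : ∀ U : Ultrafilter ℕ, (U : Filter ℕ) ≤ atTop → ∃ w, (0 : E) ∈ A w ∧
      ∀ h, Tendsto (fun n => ⟪x n, h⟫_ℝ) U (𝓝 ⟪w, h⟫_ℝ) := by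
    intro U hU
    obtain ⟨w, hw⟩ := exists_weak_limit U x _ (Eventually.of_forall hbd)
    refine ⟨w, hsurj.mem_of_forall fun y v hv => ?_, hw⟩
    have hw' : ∀ h, Tendsto (fun n => ⟪x (n + 1), h⟫_ℝ) U (𝓝 ⟪w, h⟫_ℝ) := fun h => by
      have h1 : Tendsto (fun n => ⟪γ • u n, h⟫_ℝ) U (𝓝 0) := by
        have := ((hu0.mono_left hU).const_smul γ).inner (tendsto_const_nhds (x := h)) (𝕜 := ℝ)
        simpa using this
      refine (by simpa using (hw h).sub h1 : Tendsto _ _ _).congr fun n => ?_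
      rw [← inner_sub_left, ← hxu n, add_sub_cancel_right]
    have h2 : Tendsto (fun n => ⟪u n, x (n + 1) - y⟫_ℝ) U (𝓝 0) := by
      refine squeeze_zero_norm (a := fun n => ‖u n‖ * (‖x 0 - e₀‖ + ‖e₀‖ + ‖y‖)) (fun n => ?_) ?_
      · refine (norm_inner_le_norm _ _).trans ?_
        gcongr
        exact (norm_sub_le _ _).trans (by gcongr; exact hbd _)
      · simpa using (hu0.mono_left hU).norm.mul_const (‖x 0 - e₀‖ + ‖e₀‖ + ‖y‖)
    have h3 : Tendsto (fun n => ⟪u n - v, x (n + 1) - y⟫_ℝ) U (𝓝 ⟪0 - v, w - y⟫_ℝ) := by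
      have h4 := h2.sub ((hw' v).sub_const ⟪y, v⟫_ℝ)
      have e1 : ∀ a b : E, ⟪a - v, b - y⟫_ℝ = ⟪a, b - y⟫_ℝ - (⟪b, v⟫_ℝ - ⟪y, v⟫_ℝ) := fun a b => by
        rw [inner_sub_left, ← inner_sub_left b, real_inner_comm (b - y) v]
      rw [e1, inner_zero_left]
      exact h4.congr fun n => (e1 _ _).symm
    exact ge_of_tendsto' h3 fun n => hA _ _ _ (hu n) _ hv
  -- Opial's argument: `‖x n - e‖` converges for every zero `e`, so there is one weak cluster point
  have hunique : ∀ (U V : Ultrafilter ℕ) (p q : E), (U : Filter ℕ) ≤ atTop →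
      (V : Filter ℕ) ≤ atTop → (0 : E) ∈ A p → (0 : E) ∈ A q →
      (∀ h, Tendsto (fun n => ⟪x n, h⟫_ℝ) U (𝓝 ⟪p, h⟫_ℝ)) →
      (∀ h, Tendsto (fun n => ⟪x n, h⟫_ℝ) V (𝓝 ⟪q, h⟫_ℝ)) → p = q := by
    intro U V p q hU hV hp hq hUp hVq
    obtain ⟨l, hl⟩ := hconv p hp
    obtain ⟨m, hm⟩ := hconv q hq
    have h1 : Tendsto (fun n => ⟪x n, p - q⟫_ℝ) atTop
        (𝓝 ((m - l + (‖p‖ ^ 2 - ‖q‖ ^ 2)) / 2)) := by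
      refine (((hm.sub hl).add_const (‖p‖ ^ 2 - ‖q‖ ^ 2)).div_const 2).congr fun n => ?_
      rw [norm_sub_sq_real, norm_sub_sq_real, inner_sub_right]
      ring
    have h2 : ⟪p, p - q⟫_ℝ = ⟪q, p - q⟫_ℝ :=
      (tendsto_nhds_unique (hUp _) (h1.mono_left hU)).trans
        (tendsto_nhds_unique (h1.mono_left hV) (hVq _))
    rw [← sub_eq_zero, ← inner_sub_left, inner_self_eq_zero, sub_eq_zero] at h2
    exact h2
  obtain ⟨xs, hxs, hlim⟩ := hcluster (Ultrafilter.of atTop) (Ultrafilter.of_le _)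
  refine ⟨xs, hxs, ?_⟩
  have hinner : ∀ h, Tendsto (fun n => ⟪x n, h⟫_ℝ) atTop (𝓝 ⟪xs, h⟫_ℝ) := fun h => by
    rw [tendsto_iff_ultrafilter]
    intro V hV
    obtain ⟨w, hw, hVw⟩ := hcluster V hV
    rw [hunique _ V xs w (Ultrafilter.of_le _) hV hxs hw hlim hVw]
    exact hVw h
  have hinj : Function.Injective (topDualPairing ℝ E).flip := fun y z hyz =>
    ext_inner_left ℝ fun h => by simpa using DFunLike.congr_fun hyz (innerSL ℝ h)
  refine (WeakBilin.tendsto_iff_forall_eval_tendsto _ hinj).mpr fun φ => ?_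
  have hφ : ∀ y : E, ⟪y, (InnerProductSpace.toDual ℝ E).symm φ⟫_ℝ = φ y := fun y => by
    rw [real_inner_comm, InnerProductSpace.toDual_symm_apply]
  have := hinner ((InnerProductSpace.toDual ℝ E).symm φ)
  simp only [hφ] at this
  exact this
end General

/-! ### The Lur'e operator -/

section Operators

variable {H₁ H₂ : Type*} [NormedAddCommGroup H₁] [InnerProductSpace ℝ H₁]
  [NormedAddCommGroup H₂] [InnerProductSpace ℝ H₂]
  {P : H₁ →L[ℝ] H₁} {f : H₁ → H₁} {B : H₂ →L[ℝ] H₁} {C : H₁ →L[ℝ] H₂} {D : H₂ →L[ℝ] H₂}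
  {𝓕 : H₂ → Set H₂}

theorem mem_invAdd_iff {v u : H₂} : u ∈ invAdd 𝓕 D v ↔ u - D v ∈ inv 𝓕 v := by
  simp [invAdd, sub_eq_add_neg]

theorem mem_lureOp_iff {x h : H₁} :
    h ∈ lureOp P f B C D 𝓕 x ↔ ∃ v, C x ∈ invAdd 𝓕 D v ∧ P (f x) + P (B v) = h := by
  simp only [lureOp, Set.mem_add, Set.mem_singleton_iff, Set.mem_image, exists_eq_left,
    exists_exists_and_eq_and]
  rfl

theorem inner_le_of_mem_invAdd (h𝓕 : IsMonotone 𝓕) {v w u d : H₂} (hu : u ∈ invAdd 𝓕 D v)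
    (hd : d ∈ invAdd 𝓕 D w) : ⟪D (v - w), v - w⟫_ℝ ≤ ⟪v - w, u - d⟫_ℝ := by
  have h := h𝓕.inv v w _ (mem_invAdd_iff.mp hu) _ (mem_invAdd_iff.mp hd)
  have e : (u - D v) - (d - D w) = (u - d) - D (v - w) := by rw [map_sub]; abel
  rw [e, inner_sub_left] at h
  rw [real_inner_comm (u - d)]
  linarith

end Operators

section System

variable {H₁ H₂ : Type*}
  [NormedAddCommGroup H₁] [InnerProductSpace ℝ H₁] [CompleteSpace H₁]
  [NormedAddCommGroup H₂] [InnerProductSpace ℝ H₂] [CompleteSpace H₂]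
  {P : H₁ →L[ℝ] H₁} {f : H₁ → H₁} {B : H₂ →L[ℝ] H₁} {C : H₁ →L[ℝ] H₂} {D : H₂ →L[ℝ] H₂}
  {𝓕 : H₂ → Set H₂}

theorem IsPassive.inner_nonneg (hp : IsPassive P f B C D) (y : H₂) : 0 ≤ ⟪D y, y⟫_ℝ := by
  simpa using hp.passive 0 0 y 0

/-- Passivity together with monotonicity of `𝓕`. The defects `C x - u` and `C x' - d` vanish for
the Lur'e operator itself and equal `r v` for its regularization. -/
theorem IsPassive.le_inner (hp : IsPassive P f B C D) (h𝓕 : IsMonotone 𝓕) {x x' : H₁}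
    {v w u d : H₂} (hu : u ∈ invAdd 𝓕 D v) (hd : d ∈ invAdd 𝓕 D w) :
    ⟪v - w, (C x - u) - (C x' - d)⟫_ℝ ≤
      ⟪(P (f x) + P (B v)) - (P (f x') + P (B w)), x - x'⟫_ℝ := by
  have h1 := inner_le_of_mem_invAdd h𝓕 hu hd
  have h2 := hp.passive x x' v w
  have e1 : (P ∘L B - C.adjoint) (v - w) = (P (B v) - P (B w)) - C.adjoint (v - w) := by simp
  have e2 : (P (f x) + P (B v)) - (P (f x') + P (B w))
      = P (f x - f x') + (P (B v) - P (B w)) := by rw [map_sub]; abel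
  have e3 : (C x - u) - (C x' - d) = C (x - x') - (u - d) := by rw [map_sub]; abel
  rw [e1, inner_sub_left _ (C.adjoint (v - w)), ContinuousLinearMap.adjoint_inner_left] at h2
  rw [e2, e3, inner_add_left, inner_sub_right]
  linarith

theorem IsPassive.isMonotone_invAdd (hp : IsPassive P f B C D) (h𝓕 : IsMonotone 𝓕) :
    IsMonotone (invAdd 𝓕 D) := fun v w u hu d hd => by
  rw [real_inner_comm]
  exact (hp.inner_nonneg _).trans (inner_le_of_mem_invAdd h𝓕 hu hd)

theorem IsPassive.isMonotone_lureOp (hp : IsPassive P f B C D) (h𝓕 : IsMonotone 𝓕) :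
    IsMonotone (lureOp P f B C D 𝓕) := by
  intro x y h hh k hk
  obtain ⟨v, hv, rfl⟩ := mem_lureOp_iff.mp hh
  obtain ⟨w, hw, rfl⟩ := mem_lureOp_iff.mp hk
  simpa using hp.le_inner h𝓕 (x := x) (x' := y) hv hw

/-- `𝓕⁻¹ + D` is maximal monotone. -/
theorem IsPassive.hasFullResolvent_invAdd (hp : IsPassive P f B C D)
    (h𝓕 : IsMaximalMonotone 𝓕) : HasFullResolvent (invAdd 𝓕 D) :=
  exists_resolvent_add_lipschitz h𝓕.1.inv h𝓕.hasFullResolvent_inv D.lipschitz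
    (hp.isMonotone_invAdd h𝓕.1)

/-- The regularized inclusion, with `(𝓕⁻¹ + D)⁻¹` replaced by its Yosida approximation
`(𝓕⁻¹ + D + r I)⁻¹`, is solvable: the resulting operator is Lipschitz, and still monotone by
`IsPassive.le_inner`. -/
theorem IsPassive.exists_regularized (hp : IsPassive P f B C D) (h𝓕 : IsMaximalMonotone 𝓕)
    (hf : ∃ L : NNReal, LipschitzWith L f) {γ : ℝ} (hγ : 0 < γ) (p : H₁) {r : ℝ} (hr : 0 < r) :
    ∃ z v, C z - r • v ∈ invAdd 𝓕 D v ∧ z + γ • (P (f z) + P (B v)) = p := by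
  obtain ⟨L, hL⟩ := hf
  have hM : ∀ q : H₂, ∃ v, q - r • v ∈ invAdd 𝓕 D v := fun q => by
    obtain ⟨v, u, hu, h⟩ := hp.hasFullResolvent_invAdd h𝓕 r⁻¹ (inv_pos.mpr hr) (r⁻¹ • q)
    refine ⟨v, ?_⟩
    have : q - r • v = u := by
      have := congrArg (fun y => r • y) h
      simp only [smul_add, smul_inv_smul₀ hr.ne'] at this
      rw [← this, add_sub_cancel_left]
    rwa [this]
  choose Y hY using hM
  have hYL : LipschitzWith (Real.toNNReal r⁻¹) Y := LipschitzWith.of_dist_le_mul fun q q' => by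
    rw [Real.coe_toNNReal _ (by positivity), dist_eq_norm, dist_eq_norm]
    have h := hp.isMonotone_invAdd h𝓕.1 _ _ _ (hY q) _ (hY q')
    have e : (q - r • Y q) - (q' - r • Y q') = (q - q') - r • (Y q - Y q') := by
      rw [smul_sub]; abel
    rw [e, inner_sub_left, real_inner_smul_left, real_inner_self_eq_norm_sq] at h
    have h1 := real_inner_le_norm (q - q') (Y q - Y q')
    rw [inv_mul_eq_div, le_div_iff₀ hr]
    rcases (norm_nonneg (Y q - Y q')).eq_or_lt with h0 | h0
    · rw [← h0]; simp
    · refine le_of_mul_le_mul_right ?_ h0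
      nlinarith
  have hG : LipschitzWith _ fun z => P (f z) + P (B (Y (C z))) :=
    (P.lipschitz.comp hL).add (P.lipschitz.comp (B.lipschitz.comp (hYL.comp C.lipschitz)))
  obtain ⟨z, hz⟩ := exists_add_smul_eq_of_lipschitz hG (fun x y => by
    refine le_trans ?_ (hp.le_inner h𝓕.1 (hY (C x)) (hY (C y)))
    rw [sub_sub_cancel, sub_sub_cancel, ← smul_sub, real_inner_smul_right]
    exact mul_nonneg hr.le real_inner_self_nonneg) hγ p
  exact ⟨z, Y (C z), hY _, hz⟩

/-- An estimate uniform in the regularization parameter `r ≤ 1`: it bounds `-⟪v, w⟫` for every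
`w = C x' - d` with `d` in the range of `𝓕⁻¹ + D`. -/
theorem IsPassive.regularized_bound (hp : IsPassive P f B C D) (h𝓕 : IsMonotone 𝓕) {γ : ℝ}
    (hγ : 0 < γ) {p z x' : H₁} {r : ℝ} (hr : 0 < r) (hr1 : r ≤ 1) {v e d : H₂}
    (hv : C z - r • v ∈ invAdd 𝓕 D v) (hz : z + γ • (P (f z) + P (B v)) = p)
    (hd : d ∈ invAdd 𝓕 D e) :
    ‖z - x'‖ ^ 2 / (2 * γ) - ⟪v, C x' - d⟫_ℝ ≤
      ‖p - x' - γ • (P (f x') + P (B e))‖ ^ 2 / (2 * γ) + ‖e‖ ^ 2 - ⟪e, C x' - d⟫_ℝ := by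
  have h1 := hp.le_inner h𝓕 (x := z) (x' := x') hv hd
  set g := P (f x') + P (B e)
  have h2 : P (f z) + P (B v) = γ⁻¹ • (p - z) := by
    rw [← hz, add_sub_cancel_left, inv_smul_smul₀ hγ.ne']
  have h3 : P (f z) + P (B v) - g = γ⁻¹ • ((p - x' - γ • g) - (z - x')) := by
    rw [h2, smul_sub _ (p - x' - γ • g), smul_sub _ (p - x'), inv_smul_smul₀ hγ.ne']
    simp only [smul_sub]; abel
  rw [sub_sub_cancel, h3, real_inner_smul_left, inner_sub_left _ (z - x') (z - x'),
    real_inner_self_eq_norm_sq, inner_sub_right] at h1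
  have h4 : ⟪p - x' - γ • g, z - x'⟫_ℝ
      ≤ (‖p - x' - γ • g‖ ^ 2 + ‖z - x'‖ ^ 2) / 2 := by
    have := real_inner_le_norm (p - x' - γ • g) (z - x')
    nlinarith [sq_nonneg (‖p - x' - γ • g‖ - ‖z - x'‖)]
  have h5 : γ⁻¹ * (⟪p - x' - γ • g, z - x'⟫_ℝ - ‖z - x'‖ ^ 2)
      ≤ ‖p - x' - γ • g‖ ^ 2 / (2 * γ) - ‖z - x'‖ ^ 2 / (2 * γ) := by
    rw [← sub_div, inv_mul_eq_div, div_le_div_iff₀ hγ (by positivity)]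
    nlinarith
  have h6 : -‖e‖ ^ 2 ≤ ⟪v - e, r • v⟫_ℝ := by
    rw [real_inner_smul_right, inner_sub_left, real_inner_self_eq_norm_sq]
    have := le_of_abs_le (abs_real_inner_le_norm e v)
    nlinarith [sq_nonneg (‖e‖ - ‖v‖), sq_nonneg ‖e‖, sq_nonneg ‖v‖,
      mul_nonneg hr.le (sub_nonneg.mpr this), mul_nonneg (sub_nonneg.mpr hr1) (sq_nonneg ‖e‖),
      mul_nonneg hr.le (sq_nonneg (‖e‖ - ‖v‖)), mul_nonneg hr.le (sq_nonneg ‖v‖)]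
  rw [inner_sub_left v e (C x' - d)] at h1
  linarith

/-- The Lur'e operator is maximal monotone. The constraint qualification enters through the bound on
the regularized multipliers `v n`. -/
theorem IsPassive.hasFullResolvent_lureOp (hp : IsPassive P f B C D)
    (h𝓕 : IsMaximalMonotone 𝓕) (hf : ∃ L : NNReal, LipschitzWith L f)
    (hri : (0 : H₂) ∈ relInterior (Set.range C - rge (invAdd 𝓕 D))) :
    HasFullResolvent (lureOp P f B C D 𝓕) := by
  intro γ hγ p
  -- the regularization parameters
  let r : ℕ → ℝ := fun n => 1 / ((n : ℝ) + 1)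
  have hr : ∀ n, 0 < r n := fun n => Nat.one_div_pos_of_nat
  have hr1 : ∀ n, r n ≤ 1 := fun n => by
    simpa [r] using Nat.one_div_le_one_div (α := ℝ) (Nat.zero_le n)
  have hr0 : Tendsto r atTop (𝓝 0) := tendsto_one_div_add_atTop_nhds_zero_nat
  choose z v hv hz using fun n => hp.exists_regularized h𝓕 hf hγ p (hr n)
  obtain ⟨K, hK⟩ : ∃ K, ∀ n, ‖v n‖ ≤ K := by
    refine exists_norm_bound hri hr (fun n => ?_) ?_
    · exact ⟨C (z n), ⟨z n, rfl⟩, _, Set.mem_iUnion.mpr ⟨v n, hv n⟩, sub_sub_cancel _ _⟩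
    · rintro _ ⟨_, ⟨x', rfl⟩, d, hd, rfl⟩
      obtain ⟨e, hd⟩ := Set.mem_iUnion.mp hd
      refine ⟨_, fun n => le_trans ?_
        (hp.regularized_bound h𝓕.1 hγ (x' := x') (hr n) (hr1 n) (hv n) (hz n) hd)⟩
      have : 0 ≤ ‖z n - x'‖ ^ 2 / (2 * γ) := by positivity
      simp only
      linarith
  have hK0 : 0 ≤ K := (norm_nonneg _).trans (hK 0)
  have hdist : ∀ m n, ‖z m - z n‖ ^ 2 ≤ γ * (2 * K * (r m * K + r n * K)) := fun m n => by
    have h1 := hp.le_inner h𝓕.1 (x := z m) (x' := z n) (hv m) (hv n)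
    have e : ∀ n, P (f (z n)) + P (B (v n)) = γ⁻¹ • (p - z n) := fun n => by
      rw [← hz n, add_sub_cancel_left, inv_smul_smul₀ hγ.ne']
    rw [sub_sub_cancel, sub_sub_cancel, e, e, ← smul_sub, sub_sub_sub_cancel_left,
      ← neg_sub (z m), smul_neg, inner_neg_left, real_inner_smul_left, real_inner_self_eq_norm_sq]
      at h1
    have h2 : -(2 * K * (r m * K + r n * K)) ≤ ⟪v m - v n, r m • v m - r n • v n⟫_ℝ := by
      refine (neg_le_neg ?_).trans (neg_le_of_abs_le (abs_real_inner_le_norm _ _))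
      have h3 : ‖v m - v n‖ ≤ 2 * K := (norm_sub_le _ _).trans (by linarith [hK m, hK n])
      have h4 : ‖r m • v m - r n • v n‖ ≤ r m * K + r n * K := by
        refine (norm_sub_le _ _).trans ?_
        rw [norm_smul, norm_smul, Real.norm_of_nonneg (hr m).le, Real.norm_of_nonneg (hr n).le]
        have := hr m; have := hr n
        gcongr
        · exact hK m
        · exact hK n
      gcongr
    have h3 : γ⁻¹ * ‖z m - z n‖ ^ 2 ≤ 2 * K * (r m * K + r n * K) := by linarith
    rwa [inv_mul_le_iff₀ hγ] at h3
  -- the states converge strongly and the multipliers weakly, which suffices to pass to the limit in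
  -- the inclusion
  have hcauchy : CauchySeq z := by
    refine cauchySeq_of_le_tendsto_0 (fun N => √(γ * (2 * K * (r N * K + r N * K))))
      (fun m n N hm hn => ?_) ?_
    · rw [dist_eq_norm]
      refine Real.le_sqrt_of_sq_le ((hdist m n).trans ?_)
      have := Nat.one_div_le_one_div (α := ℝ) hm
      have := Nat.one_div_le_one_div (α := ℝ) hn
      gcongr
    · have : Tendsto (fun N => √(γ * (2 * K * (r N * K + r N * K)))) atTop
          (𝓝 √(γ * (2 * K * (0 * K + 0 * K)))) :=
        ((((hr0.mul_const K).add (hr0.mul_const K)).const_mul (2 * K)).const_mul γ).sqrt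
      simpa using this
  obtain ⟨zs, hzs⟩ := cauchySeq_tendsto_of_complete hcauchy
  let U : Ultrafilter ℕ := Ultrafilter.of atTop
  have hU : (U : Filter ℕ) ≤ atTop := Ultrafilter.of_le _
  obtain ⟨vs, hvs⟩ := exists_weak_limit U v K (Eventually.of_forall hK)
  have hu : Tendsto (fun n => C (z n) - r n • v n) atTop (𝓝 (C zs)) := by
    have h1 : Tendsto (fun n => r n • v n) atTop (𝓝 0) := by
      refine squeeze_zero_norm (fun n => ?_) (by simpa using hr0.mul_const K)
      rw [norm_smul, Real.norm_of_nonneg (hr n).le]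
      exact mul_le_mul_of_nonneg_left (hK n) (hr n).le
    simpa using ((C.continuous.tendsto zs).comp hzs).sub h1
  have hmem : C zs ∈ invAdd 𝓕 D vs := by
    refine (hp.hasFullResolvent_invAdd h𝓕).mem_of_forall fun e d hd => ?_
    have h1 : Tendsto (fun n => ⟪v n, (C (z n) - r n • v n) - C zs⟫_ℝ) atTop (𝓝 0) := by
      refine squeeze_zero_norm (a := fun n => K * ‖(C (z n) - r n • v n) - C zs‖) (fun n => ?_) ?_
      · exact (norm_inner_le_norm _ _).trans (by gcongr; exact hK n)
      · simpa using ((hu.sub_const (C zs)).norm).const_mul K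
    have h2 : Tendsto (fun n => ⟪e, (C (z n) - r n • v n) - d⟫_ℝ) atTop (𝓝 ⟪e, C zs - d⟫_ℝ) :=
      tendsto_const_nhds.inner (hu.sub_const d)
    have h3 := ((h1.mono_left hU).add (hvs (C zs - d))).sub (h2.mono_left hU)
    rw [zero_add, ← inner_sub_left, real_inner_comm] at h3
    refine ge_of_tendsto' h3 fun n => ?_
    rw [← inner_add_right, sub_add_sub_cancel, ← inner_sub_left, real_inner_comm]
    exact hp.isMonotone_invAdd h𝓕.1 _ _ _ (hv n) _ hd
  refine ⟨zs, _, mem_lureOp_iff.mpr ⟨vs, hmem, rfl⟩, ext_inner_right ℝ fun h => ?_⟩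
  obtain ⟨L, hL⟩ := hf
  have h1 : Tendsto (fun n => ⟪z n + γ • P (f (z n)), h⟫_ℝ) atTop
      (𝓝 ⟪zs + γ • P (f zs), h⟫_ℝ) :=
    (hzs.add (((P.continuous.comp hL.continuous).tendsto zs).comp hzs |>.const_smul γ)).inner
      tendsto_const_nhds
  have hB : ∀ w, ⟪γ • P (B w), h⟫_ℝ = ⟪w, γ • (P ∘L B).adjoint h⟫_ℝ := fun w => by
    rw [real_inner_smul_left, real_inner_smul_right, ContinuousLinearMap.adjoint_inner_right]
    rfl
  have h2 := (h1.mono_left hU).add (hvs (γ • (P ∘L B).adjoint h))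
  simp_rw [← hB, ← inner_add_left, add_assoc, ← smul_add, hz] at h2
  exact tendsto_nhds_unique h2 tendsto_const_nhds

/-- Equilibria are the zeros of the Lur'e operator, because `P` is injective. -/
theorem IsPassive.isEquilibrium_iff (hp : IsPassive P f B C D) {x : H₁} :
    IsEquilibrium f B C D 𝓕 x ↔ (0 : H₁) ∈ lureOp P f B C D 𝓕 x := by
  have hP : ∀ y, P y = 0 → y = 0 := fun y hy => by
    by_contra hne
    simpa [hy] using hp.pos y hne
  have h : IsEquilibrium f B C D 𝓕 x ↔ ∃ v, C x ∈ invAdd 𝓕 D v ∧ f x + B v = 0 := by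
    simp only [IsEquilibrium, Set.mem_add, Set.mem_singleton_iff, Set.mem_image, exists_eq_left,
      exists_exists_and_eq_and]
    rfl
  rw [h, mem_lureOp_iff]
  refine exists_congr fun v => and_congr_right fun _ => ?_
  rw [← map_add]
  exact ⟨fun h => by rw [h, map_zero], hP _⟩

end System

end Lure

theorem theorem3p2
    {H₁ H₂ : Type*}
    [NormedAddCommGroup H₁] [InnerProductSpace ℝ H₁] [CompleteSpace H₁]
    [NormedAddCommGroup H₂] [InnerProductSpace ℝ H₂] [CompleteSpace H₂]
    (P : H₁ →L[ℝ] H₁) (f : H₁ → H₁) (B : H₂ →L[ℝ] H₁) (C : H₁ →L[ℝ] H₂) (D : H₂ →L[ℝ] H₂)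
    (𝓕 : H₂ → Set H₂)
    (hpassive : Lure.IsPassive P f B C D)
    (hf : ∃ L : NNReal, LipschitzWith L f)
    (hD : Lure.IsSemiCoercive D)
    (hmax : Lure.IsMaximalMonotone 𝓕)
    (hri : (0 : H₂) ∈ Lure.relInterior (Set.range C - Lure.rge (Lure.invAdd 𝓕 D)))
    (hy₀ : ∃ y₀ : H₂, ∀ x : H₁, C x ∈ Lure.rge (Lure.invAdd 𝓕 D) →
      (({y₀} + Set.range (D + D.adjoint)) ∩ Lure.inv (Lure.invAdd 𝓕 D) (C x)).Nonempty)
    (γ : ℝ) (hγ : 0 < γ) :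
    (∀ x : H₁, ∃! z : H₁, z ∈ Lure.resolvent γ (Lure.lureOp P f B C D 𝓕) x) ∧
    ((∃ x : H₁, Lure.IsEquilibrium f B C D 𝓕 x) →
      ∀ x : ℕ → H₁,
        (∀ n, x (n + 1) ∈ Lure.resolvent γ (Lure.lureOp P f B C D 𝓕) (x n)) →
        ∃ xs : H₁, Lure.IsEquilibrium f B C D 𝓕 xs ∧
          Tendsto (fun n => toWeakSpace ℝ H₁ (x n)) atTop (𝓝 (toWeakSpace ℝ H₁ xs))) := by
  have hmono := hpassive.isMonotone_lureOp hmax.1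
  have hsurj := hpassive.hasFullResolvent_lureOp hmax hf hri
  refine ⟨fun x => ?_, fun ⟨e, he⟩ x hx => ?_⟩
  · obtain ⟨z, u, hu, hz⟩ := hsurj γ hγ x
    refine ⟨z, Lure.mem_resolvent_iff.mpr ⟨u, hu, hz⟩, fun y hy => ?_⟩
    obtain ⟨v, hv, hy⟩ := Lure.mem_resolvent_iff.mp hy
    have h := hmono.norm_sub_le hγ hv hu
    rw [hy, hz, sub_self, norm_zero] at h
    exact sub_eq_zero.mp (norm_le_zero_iff.mp h)
  · obtain ⟨xs, hxs, hlim⟩ := Lure.tendsto_proximal_point hmono hsurj hγ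
      ⟨e, hpassive.isEquilibrium_iff.mp he⟩ hx
    exact ⟨xs, hpassive.isEquilibrium_iff.mpr hxs, hlim⟩
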